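/- Let $H^2=H^2(\mathbb T)$ be the Hardy space on the unit circle $\mathbb T$ (the functions in $L^2(\mathbb T)$, with respect to normalized Lebesgue measure, whose negative Fourier coefficients vanish), identified as usual with a space of analytic functions on the unit disk, so that $f(0)$ is the zeroth Fourier coefficient of $f$. Let $S$ be the shift $Sf=zf$ on $H^2$ and $S^*$ its adjoint. An inner function is a bounded analytic function on the disk whose boundary values have modulus $1$ a.e. on $\mathbb T$, i.e. an element $\theta$ of $H^2$ with $|\theta|=1$ a.e. on $\mathbb T$; unimodular constants are allowed. For $\theta$ inner put $K_\theta=H^2\ominus\theta H^2$ (so $K_\theta=\{0\}$ if $\theta$ is constant). Let $H^2_{\mathbb C^2}=H^2\oplus H^2$ be the vector-valued Hardy space. A splitting subspace of $H^2_{\mathbb C^2}$ is a subspace $\mathcal N_1\oplus\mathcal N_2$ with $\mathcal N_1,\mathcal N_2$ closed subspaces of $H^2$. A closed subspace $\mathcal F$ of a Hilbert space $\mathcal H$ is nearly $T$-invariant, for a bounded operator $T$ on $\mathcal H$, if $T(\mathcal F\cap T^*\mathcal H)\subset\mathcal F$. Let $\mathcal M=\mathcal N_1\oplus\mathcal N_2\neq\{0\}$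 be a splitting subspace of $H^2_{\mathbb C^2}$ that is nearly $(S\oplus S^*)$-invariant. Then $\mathcal M$ has one of the following forms, where $\alpha,\beta,\gamma$ are inner functions: 1. $\alpha H^2\oplus K_\beta$; 2. $\{0\}\oplus K_\beta$; 3. $\alpha H^2\oplus\gamma H^2$ with $\gamma(0)\ne0$; 4. $\{0\}\oplus\gamma H^2$ with $\gamma(0)\neq0$; 5. $\alpha H^2\oplus gK_\beta$; 6. $\{0\}\oplus gK_\beta$. In forms 5 and 6, $g\in H^2$ satisfies $gk\in H^2$ for all $k\in K_\beta$, and $g$ is the extremal function of $\mathcal N_2=gK_\beta$: the unit vector of $\mathcal N_2$ that is orthogonal to $\{f\in\mathcal N_2: f(0)=0\}$ and satisfies $g(0)>0$. -/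

import Mathlib

open MeasureTheory AddCircle

noncomputable section

namespace Hardy

/-- The unit circle `𝕋`, parametrised by `t ↦ exp (2 π i t)` on `ℝ / ℤ`. -/
abbrev Circ : Type := AddCircle (1 : ℝ)

/-- Normalised Lebesgue measure on the unit circle. -/
abbrev mu : Measure Circ := haarAddCircle

/-- `L²(𝕋)`. -/
abbrev L2 : Type := Lp ℂ 2 mu

/-- `H² = H²(𝕋)`: the functions in `L²(𝕋)` whose negative Fourier coefficients vanish. -/
def H2 : Submodule ℂ L2 where
  carrier := {f | ∀ n : ℤ, n < 0 → fourierCoeff (f : Circ → ℂ) n = 0}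
  zero_mem' := by
    intro n _
    rw [← fourierBasis_repr]
    simp
  add_mem' := by
    intro f g hf hg n hn
    have h1 := hf n hn
    have h2 := hg n hn
    rw [← fourierBasis_repr] at h1 h2 ⊢
    rw [map_add, lp.coeFn_add, Pi.add_apply, h1, h2, add_zero]
  smul_mem' := by
    intro c f hf n hn
    have h1 := hf n hn
    rw [← fourierBasis_repr] at h1 ⊢
    rw [map_smul, lp.coeFn_smul, Pi.smul_apply, h1, smul_zero]

theorem mem_H2 {f : L2} :
    f ∈ H2 ↔ ∀ n : ℤ, n < 0 → fourierCoeff (f : Circ → ℂ) n = 0 := Iff.rfl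

theorem isClosed_H2 : IsClosed (H2 : Set L2) := by
  have h : (H2 : Set L2) = ⋂ n : ℤ, ⋂ _ : n < 0,
      {f : L2 | inner ℂ (fourierBasis (T := 1) n) f = 0} := by
    ext f
    simp only [SetLike.mem_coe, mem_H2, Set.mem_iInter, Set.mem_ofPred_eq]
    refine forall_congr' fun n => forall_congr' fun _ => ?_
    rw [← fourierBasis_repr, HilbertBasis.repr_apply_apply]
  rw [h]
  refine isClosed_iInter fun n => isClosed_iInter fun _ => ?_
  exact isClosed_eq (continuous_const.inner continuous_id) continuous_const

instance : CompleteSpace H2 := isClosed_H2.completeSpace_coe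

/-- The function `z f` on the circle, where `z = exp (2 π i t)` is the coordinate function. -/
def zMul (f : Circ → ℂ) : Circ → ℂ := fun t => fourier 1 t * f t

theorem norm_fourier_apply (n : ℤ) (t : Circ) : ‖(fourier n t : ℂ)‖ = 1 := by
  rw [fourier_apply]
  exact Circle.norm_coe _

theorem memLp_zMul (f : L2) : MemLp (zMul f) 2 mu := by
  refine (Lp.memLp f).of_le ?_ ?_
  · exact ((fourier (T := 1) 1).continuous.aestronglyMeasurable).mul (Lp.aestronglyMeasurable f)
  · refine Filter.Eventually.of_forall fun t => ?_
    rw [zMul, norm_mul, norm_fourier_apply, one_mul]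

theorem fourierCoeff_zMul (f : Circ → ℂ) (n : ℤ) :
    fourierCoeff (zMul f) n = fourierCoeff f (n - 1) := by
  unfold fourierCoeff zMul
  congr 1
  funext t
  have h : (-(n - 1) : ℤ) = -n + 1 := by ring
  rw [h, fourier_add, smul_eq_mul, smul_eq_mul, mul_assoc]

/-- The shift operator `S f = z f` on `H²`. -/
def S : H2 →L[ℂ] H2 :=
  LinearMap.mkContinuous
    { toFun := fun f => ⟨(memLp_zMul (f : L2)).toLp (zMul (f : L2)), by
        intro n hn
        rw [fourierCoeff_congr_ae (MemLp.coeFn_toLp _), fourierCoeff_zMul]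
        exact f.2 (n - 1) (by omega)⟩
      map_add' := by
        intro f g
        apply Subtype.ext
        apply Lp.ext
        refine (MemLp.coeFn_toLp (memLp_zMul ((f + g : H2) : L2))).trans ?_
        rw [Submodule.coe_add]
        refine Filter.EventuallyEq.trans ?_ (Lp.coeFn_add _ _).symm
        filter_upwards [MemLp.coeFn_toLp (memLp_zMul (f : L2)),
          MemLp.coeFn_toLp (memLp_zMul (g : L2)), Lp.coeFn_add (f : L2) (g : L2)]
          with t h1 h2 h3
        simp only [Pi.add_apply] at *
        rw [h1, h2]
        simp only [zMul, h3, mul_add]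
      map_smul' := by
        intro c f
        apply Subtype.ext
        apply Lp.ext
        refine (MemLp.coeFn_toLp (memLp_zMul ((c • f : H2) : L2))).trans ?_
        simp only [RingHom.id_apply]
        rw [Submodule.coe_smul]
        refine Filter.EventuallyEq.trans ?_ (Lp.coeFn_smul _ _).symm
        filter_upwards [MemLp.coeFn_toLp (memLp_zMul (f : L2)), Lp.coeFn_smul c (f : L2)]
          with t h1 h2
        simp only [Pi.smul_apply, smul_eq_mul] at *
        rw [h1]
        simp only [zMul, h2]
        ring }
    1 (by
      intro f
      rw [one_mul]
      change ‖(memLp_zMul (f : L2)).toLp (zMul (f : L2))‖ ≤ ‖(f : L2)‖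
      refine Lp.norm_le_norm_of_ae_le ?_
      filter_upwards [MemLp.coeFn_toLp (memLp_zMul (f : L2))] with t h
      rw [h, zMul, norm_mul, norm_fourier_apply, one_mul])

/-- `S f = z f` almost everywhere on the circle. -/
theorem coeFn_S (f : H2) : ((S f : L2) : Circ → ℂ) =ᵐ[mu] zMul (f : L2) :=
  MemLp.coeFn_toLp (memLp_zMul (f : L2))

/-- The value `f(0)` at the origin of (the analytic extension of) `f ∈ H²`, i.e. the zeroth
Fourier coefficient of `f`. -/
def atZero (f : H2) : ℂ := fourierCoeff ((f : L2) : Circ → ℂ) 0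

/-- Inner functions, as boundary functions: elements of `H²` of unit modulus almost everywhere on
the circle. These are exactly the boundary functions of the bounded analytic functions on the disk
with unimodular boundary values; unimodular constants are included. -/
def IsInner (θ : H2) : Prop := ∀ᵐ t ∂mu, ‖((θ : L2) : Circ → ℂ) t‖ = 1

/-- `f` is the pointwise product of `g` and `k`. -/
def IsMul (f g k : H2) : Prop :=
  ((f : L2) : Circ → ℂ) =ᵐ[mu] fun t => ((g : L2) : Circ → ℂ) t * ((k : L2) : Circ → ℂ) t

/-- `gK`: all products `g k`, `k ∈ K`, that lie in `H²`. (If `g` is inner this is no restriction;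
for general `g` one adds `MulsInto g K` to say that all products `g k` do lie in `H²`.) -/
def mulSub (g : H2) (K : Submodule ℂ H2) : Submodule ℂ H2 where
  carrier := {f | ∃ k ∈ K, IsMul f g k}
  zero_mem' := by
    refine ⟨0, K.zero_mem, ?_⟩
    unfold IsMul
    rw [Submodule.coe_zero]
    filter_upwards [Lp.coeFn_zero ℂ 2 mu] with t h
    rw [h]
    simp
  add_mem' := by
    rintro f₁ f₂ ⟨k₁, hk₁, h₁⟩ ⟨k₂, hk₂, h₂⟩
    refine ⟨k₁ + k₂, K.add_mem hk₁ hk₂, ?_⟩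
    unfold IsMul at *
    rw [Submodule.coe_add, Submodule.coe_add]
    filter_upwards [h₁, h₂, Lp.coeFn_add (f₁ : L2) (f₂ : L2), Lp.coeFn_add (k₁ : L2) (k₂ : L2)]
      with t e₁ e₂ e₃ e₄
    rw [e₃, e₄, Pi.add_apply, Pi.add_apply, e₁, e₂, mul_add]
  smul_mem' := by
    rintro c f ⟨k, hk, h⟩
    refine ⟨c • k, K.smul_mem c hk, ?_⟩
    unfold IsMul at *
    rw [Submodule.coe_smul, Submodule.coe_smul]
    filter_upwards [h, Lp.coeFn_smul c (f : L2), Lp.coeFn_smul c (k : L2)] with t e₁ e₂ e₃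
    rw [e₂, e₃, Pi.smul_apply, Pi.smul_apply, e₁, smul_eq_mul, smul_eq_mul]
    ring

/-- Every product `g k` with `k ∈ K` lies in `H²`. -/
def MulsInto (g : H2) (K : Submodule ℂ H2) : Prop := ∀ k ∈ K, ∃ f : H2, IsMul f g k

/-- `θH²`. -/
def beurling (θ : H2) : Submodule ℂ H2 := mulSub θ ⊤

/-- For inner `θ` every product `θ h`, `h ∈ H²`, lies in `H²`; so `beurling θ` is all of `θH²`. -/
theorem IsInner.exists_isMul {θ : H2} (hθ : IsInner θ) (h : H2) : ∃ f : H2, IsMul f θ h := by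
  have hm : MemLp (fun t => ((θ : L2) : Circ → ℂ) t * ((h : L2) : Circ → ℂ) t) 2 mu := by
    refine (Lp.memLp (h : L2)).of_le ((Lp.aestronglyMeasurable _).mul (Lp.aestronglyMeasurable _)) ?_
    filter_upwards [hθ] with t ht
    rw [norm_mul, ht, one_mul]
  refine ⟨⟨hm.toLp _, ?_⟩, hm.coeFn_toLp⟩
  intro n hn
  rw [fourierCoeff_congr_ae hm.coeFn_toLp]
  have hw : MemLp (fun t => (fourier n t : ℂ) * (starRingEnd ℂ) (((θ : L2) : Circ → ℂ) t)) 2 mu := by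
    refine (Lp.memLp (θ : L2)).of_le (((fourier (T := 1) n).continuous.aestronglyMeasurable).mul ?_) ?_
    · exact Complex.continuous_conj.comp_aestronglyMeasurable (Lp.aestronglyMeasurable _)
    · refine Filter.Eventually.of_forall fun t => ?_
      rw [norm_mul, norm_fourier_apply, one_mul, RCLike.norm_conj]
  have e1 : fourierCoeff (fun t => ((θ : L2) : Circ → ℂ) t * ((h : L2) : Circ → ℂ) t) n
      = inner ℂ (hw.toLp _) (h : L2) := by
    rw [L2.inner_def]; unfold fourierCoeff
    apply integral_congr_ae
    filter_upwards [hw.coeFn_toLp] with t ht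
    rw [ht, RCLike.inner_apply, map_mul, ← fourier_neg, RCLike.conj_conj, smul_eq_mul]; ring
  rw [e1, ← (fourierBasis (T := (1:ℝ))).tsum_inner_mul_inner]
  refine (tsum_congr fun k => ?_).trans tsum_zero
  rcases lt_or_ge k 0 with hk | hk
  · have := h.2 k hk
    rw [← fourierBasis_repr, HilbertBasis.repr_apply_apply] at this
    rw [this, mul_zero]
  · have : inner ℂ (hw.toLp _) (fourierBasis (T := (1:ℝ)) k) = fourierCoeff ((θ : L2) : Circ → ℂ) (n - k) := by
      rw [L2.inner_def]; unfold fourierCoeff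
      apply integral_congr_ae
      rw [coe_fourierBasis]
      filter_upwards [hw.coeFn_toLp, coeFn_fourierLp (T := (1:ℝ)) 2 k] with t ht h2
      have e : -(n - k) = k + -n := by ring
      rw [ht, h2, RCLike.inner_apply, map_mul, ← fourier_neg, RCLike.conj_conj, smul_eq_mul, e, fourier_add]; ring
    rw [this, θ.2 _ (by omega), zero_mul]

/-- The model space `K_θ = H² ⊖ θH²`. -/
def model (θ : H2) : Submodule ℂ H2 := (beurling θ)ᗮ

/-- `g` is the normalised extremal function of `N ⊆ H²`: the unit vector of `N` that is orthogonal
to `N ∩ zH² = {f ∈ N : f(0) = 0}` and satisfies `g(0) > 0`. -/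
def IsExtremal (g : H2) (N : Submodule ℂ H2) : Prop :=
  g ∈ N ∧ ‖g‖ = 1 ∧ (∀ f ∈ N, atZero f = 0 → inner ℂ f g = 0) ∧
    0 < (atZero g).re ∧ (atZero g).im = 0

/-- The vector-valued Hardy space `H²_{ℂ²} = H² ⊕ H²` (Hilbert space direct sum). -/
abbrev H2C2 : Type := WithLp 2 (H2 × H2)

/-- The operator `S ⊕ S*` on `H²_{ℂ²}`. -/
def SSstar : H2C2 →L[ℂ] H2C2 :=
  ((WithLp.prodContinuousLinearEquiv 2 ℂ H2 H2).symm : H2 × H2 →L[ℂ] H2C2) ∘L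
    (S.prodMap (ContinuousLinearMap.adjoint S)) ∘L
    (WithLp.prodContinuousLinearEquiv 2 ℂ H2 H2 : H2C2 →L[ℂ] H2 × H2)

/-- The subspace `N₁ ⊕ N₂` of `H²_{ℂ²}`. -/
def directSum (N₁ N₂ : Submodule ℂ H2) : Submodule ℂ H2C2 :=
  (N₁.prod N₂).comap (WithLp.linearEquiv 2 ℂ (H2 × H2)).toLinearMap

/-- Splitting subspaces of `H²_{ℂ²}`: those of the form `N₁ ⊕ N₂` with `N₁`, `N₂` closed
subspaces of `H²`. -/
def IsSplitting (M : Submodule ℂ H2C2) : Prop :=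
  ∃ N₁ N₂ : Submodule ℂ H2, IsClosed (N₁ : Set H2) ∧ IsClosed (N₂ : Set H2) ∧ M = directSum N₁ N₂

/-- A closed subspace `F` of a Hilbert space `H` is nearly `T`-invariant if
`T (F ∩ T* H) ⊆ F`. -/
def IsNearlyInvariant {H : Type*} [NormedAddCommGroup H] [InnerProductSpace ℂ H] [CompleteSpace H]
    (T : H →L[ℂ] H) (F : Submodule ℂ H) : Prop :=
  IsClosed (F : Set H) ∧
    T '' ((F : Set H) ∩ Set.range (ContinuousLinearMap.adjoint T)) ⊆ (F : Set H)

end Hardy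

end

open MeasureTheory AddCircle

noncomputable section

namespace Hardy

open Filter Topology

-- The adjoint of `S ⊕ S*` is `S* ⊕ S`, and `S*` is onto. Near invariance of `N₁ ⊕ N₂` therefore
-- decouples: `N₁` is invariant under `S`, and `N₂` is closed under division by `z` whenever the
-- quotient lies in `H²`. Beurling's theorem (`exists_eq_beurling`) describes `N₁`, Hitt's theorem
-- (`nearlyInvariant_classification`) describes `N₂`, and a zero `N₂` is `K_β` with `β = 1`.
--
-- For Hitt's theorem let `g` be the unit vector of `N₂` representing evaluation at `0` up to a
-- positive factor, and let `T = hittOp g`. On `N₂` one has `f = ⟨g, f⟩ g + z T f`, an orthogonal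
-- decomposition. Iterating it gives `f = g k` with `k = ∑ ⟨g, Tⁿ f⟩ zⁿ` and `‖k‖ = ‖f‖`, provided
-- that `Tⁿ f → 0`. The space of quotients `k` is closed and `S*`-invariant, so by Beurling it is a
-- model space, or all of `H²`, in which case `g` is inner.
--
-- The analytic core is the strong convergence `Tⁿ → 0` (`tendsto_hittOp_pow`). Since `S*` is a
-- rank-one perturbation of `T`, the vectors `(S*)ⁿ⁺¹ g` arise from `Tᵐ S* g` through the lower
-- triangle of the Gram matrix of the unit vectors `zⁿ g`. That triangle is bounded below
-- (`sum_norm_sq_le_of_gram`), so the known convergence `(S*)ⁿ → 0` passes to `T`.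

/- Without these shortcuts, `inner ℂ` elaborates to the inner product of a `C⋆`-module. -/
instance : Inner ℂ L2 := InnerProductSpace.toInner

instance : Inner ℂ H2 := InnerProductSpace.toInner

/-! ### The monomial basis of `H²` and the shift -/

theorem fourierCoeff_eq_inner (f : L2) (n : ℤ) :
    fourierCoeff (f : Circ → ℂ) n = inner ℂ (fourierLp (T := 1) 2 n : L2) f := by
  rw [← fourierBasis_repr, HilbertBasis.repr_apply_apply, coe_fourierBasis]

/-- The monomial `zⁿ` as an element of `H²`. -/
def monomial (n : ℕ) : H2 :=
  ⟨fourierLp (T := 1) 2 (n : ℤ), fun k hk => by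
    rw [fourierCoeff_eq_inner]
    exact orthonormal_fourier.2 (by omega)⟩

theorem orthonormal_monomial : Orthonormal ℂ monomial :=
  ⟨fun n => (orthonormal_fourier (T := 1)).1 n, fun m n hmn =>
    (orthonormal_fourier (T := 1)).2 (i := (m : ℤ)) (j := n) (by exact_mod_cast hmn)⟩

theorem inner_monomial (n : ℕ) (f : H2) :
    inner ℂ (monomial n) f = fourierCoeff ((f : L2) : Circ → ℂ) n := by
  rw [fourierCoeff_eq_inner]; rfl

theorem atZero_eq_inner (f : H2) : atZero f = inner ℂ (monomial 0) f := by
  rw [inner_monomial]; rfl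

theorem ext_inner_monomial {f g : H2}
    (h : ∀ n, inner ℂ (monomial n) f = inner ℂ (monomial n) g) : f = g := by
  apply Subtype.ext
  apply (fourierBasis (T := (1 : ℝ))).repr.injective
  ext n
  rw [fourierBasis_repr, fourierBasis_repr]
  rcases lt_or_ge n 0 with hn | hn
  · rw [f.2 n hn, g.2 n hn]
  · lift n to ℕ using hn
    rw [← inner_monomial, ← inner_monomial, h]

/-- The monomials form a Hilbert basis of `H²`. -/
def monomialBasis : HilbertBasis ℕ ℂ H2 :=
  HilbertBasis.mkOfOrthogonalEqBot orthonormal_monomial (by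
    rw [Submodule.eq_bot_iff]
    intro f hf
    refine ext_inner_monomial fun n => ?_
    rw [inner_zero_right]
    exact hf _ (Submodule.subset_span ⟨n, rfl⟩))

@[simp] theorem monomialBasis_apply (n : ℕ) : monomialBasis n = monomial n := by
  simp [monomialBasis]

theorem hasSum_norm_inner_monomial_sq (f : H2) :
    HasSum (fun n => ‖inner ℂ (monomial n) f‖ ^ 2) (‖f‖ ^ 2) := by
  have h := monomialBasis.hasSum_inner_mul_inner f f
  rw [inner_self_eq_norm_sq_to_K] at h
  have h2 := ((RCLike.hasSum_iff _ _).1 h).1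
  convert! h2 using 1
  · funext n
    rw [monomialBasis_apply, ← inner_conj_symm f, RCLike.conj_mul]
    norm_cast
  · norm_cast

/-- A closed subspace that contains all monomials is everything. -/
theorem eq_top_of_monomial_mem {N : Submodule ℂ H2} (hN : IsClosed (N : Set H2))
    (h : ∀ n, monomial n ∈ N) : N = ⊤ := by
  have hd := monomialBasis.dense_span
  rw [eq_top_iff, ← hd]
  refine Submodule.topologicalClosure_minimal _ (Submodule.span_le.2 ?_) hN
  rintro _ ⟨n, rfl⟩
  simpa using h n

theorem norm_S (f : H2) : ‖S f‖ = ‖f‖ := by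
  change ‖((S f : H2) : L2)‖ = ‖(f : L2)‖
  have h : ∀ᵐ t ∂mu, ‖((S f : L2) : Circ → ℂ) t‖ = ‖((f : L2) : Circ → ℂ) t‖ := by
    filter_upwards [coeFn_S f] with t h
    rw [h, zMul, norm_mul, norm_fourier_apply, one_mul]
  exact le_antisymm (Lp.norm_le_norm_of_ae_le (h.mono fun t h => h.le))
    (Lp.norm_le_norm_of_ae_le (h.mono fun t h => h.ge))

theorem inner_S_S (f g : H2) : inner ℂ (S f) (S g) = inner ℂ f g :=
  LinearIsometry.inner_map_map ⟨(S : H2 →ₗ[ℂ] H2), norm_S⟩ f g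

theorem inner_monomial_succ_S (n : ℕ) (f : H2) :
    inner ℂ (monomial (n + 1)) (S f) = inner ℂ (monomial n) f := by
  rw [inner_monomial, inner_monomial, fourierCoeff_congr_ae (coeFn_S f), fourierCoeff_zMul]
  push_cast
  rw [add_sub_cancel_right]

theorem inner_monomial_zero_S (f : H2) : inner ℂ (monomial 0) (S f) = 0 := by
  rw [inner_monomial, fourierCoeff_congr_ae (coeFn_S f), fourierCoeff_zMul]
  exact f.2 _ (by simp)

theorem S_monomial (n : ℕ) : S (monomial n) = monomial (n + 1) := by
  refine ext_inner_monomial fun k => ?_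
  cases k with
  | zero => rw [inner_monomial_zero_S, orthonormal_monomial.2 (by omega)]
  | succ k =>
    rw [inner_monomial_succ_S, orthonormal_iff_ite.1 orthonormal_monomial,
      orthonormal_iff_ite.1 orthonormal_monomial]
    simp

theorem S_pow_monomial (n m : ℕ) : (S ^ n) (monomial m) = monomial (m + n) := by
  induction n with
  | zero => simp
  | succ n ih => rw [pow_succ', mul_apply_eq_comp, ih, S_monomial, add_assoc]

theorem inner_S_pow_S_pow (n : ℕ) (f g : H2) : inner ℂ ((S ^ n) f) ((S ^ n) g) = inner ℂ f g := by
  induction n with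
  | zero => simp
  | succ n ih => rw [pow_succ', mul_apply_eq_comp, mul_apply_eq_comp,
      inner_S_S, ih]

/-- The backward shift. -/
abbrev Sadj : H2 →L[ℂ] H2 := ContinuousLinearMap.adjoint S

theorem Sadj_S (f : H2) : Sadj (S f) = f :=
  ext_inner_right ℂ fun g => by
    rw [ContinuousLinearMap.adjoint_inner_left, inner_S_S]

theorem inner_monomial_Sadj (n : ℕ) (f : H2) :
    inner ℂ (monomial n) (Sadj f) = inner ℂ (monomial (n + 1)) f := by
  rw [ContinuousLinearMap.adjoint_inner_right, S_monomial]

theorem S_Sadj_of_inner_monomial_zero {f : H2} (hf : inner ℂ (monomial 0) f = 0) :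
    S (Sadj f) = f := by
  refine ext_inner_monomial fun k => ?_
  cases k with
  | zero => rw [inner_monomial_zero_S, hf]
  | succ k => rw [inner_monomial_succ_S, inner_monomial_Sadj]

theorem norm_Sadj_le (f : H2) : ‖Sadj f‖ ≤ ‖f‖ := by
  have h : ‖S‖ ≤ 1 := S.opNorm_le_bound zero_le_one fun f => by rw [norm_S, one_mul]
  refine (Sadj.le_opNorm f).trans ?_
  rw [LinearIsometryEquiv.norm_map]
  exact mul_le_of_le_one_left (norm_nonneg _) h

theorem Sadj_monomial_succ (n : ℕ) : Sadj (monomial (n + 1)) = monomial n := by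
  rw [← S_monomial, Sadj_S]

theorem Sadj_monomial_zero : Sadj (monomial 0) = 0 := by
  refine ext_inner_monomial fun k => ?_
  rw [inner_monomial_Sadj, orthonormal_monomial.2 (by omega), inner_zero_right]

/-- The subspace on which the powers of a contraction tend strongly to zero. -/
def stableSub (A : H2 →L[ℂ] H2) : Submodule ℂ H2 where
  carrier := {f | Tendsto (fun n => (A ^ n) f) atTop (𝓝 0)}
  zero_mem' := by simp
  add_mem' := by
    intro f g hf hg
    simpa using Tendsto.add hf hg
  smul_mem' := by
    intro c f hf
    have := Tendsto.const_smul hf c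
    rw [smul_zero] at this
    simpa only [Set.mem_ofPred_eq, map_smul] using this

theorem mem_stableSub {A : H2 →L[ℂ] H2} {f : H2} :
    f ∈ stableSub A ↔ Tendsto (fun n => (A ^ n) f) atTop (𝓝 0) := Iff.rfl

/-- Allows induction on the degree of a monomial, since `S*` and `hittOp g` lower the degree up to a
stable error. -/
theorem mem_stableSub_of_apply {A : H2 →L[ℂ] H2} {f : H2} (h : A f ∈ stableSub A) :
    f ∈ stableSub A := by
  rw [mem_stableSub] at *
  rw [← tendsto_add_atTop_iff_nat 1]
  simpa only [pow_succ, mul_apply_eq_comp] using h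

theorem norm_pow_apply_le {A : H2 →L[ℂ] H2} (hA : ∀ f, ‖A f‖ ≤ ‖f‖) (n : ℕ) (f : H2) :
    ‖(A ^ n) f‖ ≤ ‖f‖ := by
  induction n with
  | zero => simp
  | succ n ih =>
    rw [pow_succ', mul_apply_eq_comp]
    exact (hA _).trans ih

theorem isClosed_stableSub {A : H2 →L[ℂ] H2} (hA : ∀ f, ‖A f‖ ≤ ‖f‖) :
    IsClosed (stableSub A : Set H2) := by
  refine isClosed_of_closure_subset fun f hf => ?_
  rw [SetLike.mem_coe, mem_stableSub, Metric.tendsto_atTop]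
  intro ε hε
  obtain ⟨g, hg, hfg⟩ := Metric.mem_closure_iff.1 hf (ε / 2) (half_pos hε)
  obtain ⟨n₀, hn₀⟩ := Metric.tendsto_atTop.1 (mem_stableSub.1 hg) (ε / 2) (half_pos hε)
  refine ⟨n₀, fun n hn => ?_⟩
  have h1 := hn₀ n hn
  have h2 := norm_pow_apply_le hA n (f - g)
  rw [dist_eq_norm] at hfg
  rw [dist_zero_right] at h1 ⊢
  calc ‖(A ^ n) f‖ = ‖(A ^ n) (f - g) + (A ^ n) g‖ := by rw [map_sub, sub_add_cancel]
    _ ≤ ‖(A ^ n) (f - g)‖ + ‖(A ^ n) g‖ := norm_add_le _ _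
    _ < ε := by linarith

theorem tendsto_Sadj_pow (f : H2) : Tendsto (fun n => (Sadj ^ n) f) atTop (𝓝 0) := by
  have h : stableSub Sadj = ⊤ := by
    refine eq_top_of_monomial_mem (isClosed_stableSub norm_Sadj_le) fun n => ?_
    induction n with
    | zero =>
      refine mem_stableSub_of_apply ?_
      rw [Sadj_monomial_zero]
      exact zero_mem _
    | succ n ih =>
      refine mem_stableSub_of_apply ?_
      rwa [Sadj_monomial_succ]
  exact mem_stableSub.1 (h ▸ Submodule.mem_top)

/-! ### Products, limits and Fourier coefficients -/

theorem coeFn_S_pow (n : ℕ) (f : H2) :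
    (((S ^ n) f : H2) : L2) =ᵐ[mu] fun t => fourier (n : ℤ) t * ((f : L2) : Circ → ℂ) t := by
  induction n with
  | zero => simp
  | succ n ih =>
    rw [pow_succ', mul_apply_eq_comp]
    filter_upwards [coeFn_S ((S ^ n) f), ih] with t h1 h2
    rw [h1, zMul, h2, ← mul_assoc, Nat.cast_succ, add_comm (n : ℤ) 1, fourier_add]

theorem coeFn_monomial (n : ℕ) :
    ((monomial n : L2) : Circ → ℂ) =ᵐ[mu] fun t => fourier (n : ℤ) t :=
  coeFn_fourierLp 2 (n : ℤ)

theorem isMul_S_pow (n : ℕ) (g : H2) : IsMul ((S ^ n) g) g (monomial n) := by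
  filter_upwards [coeFn_S_pow n g, coeFn_monomial n] with t h1 h2
  rw [h1, h2, mul_comm]

theorem IsMul.unique {f f' g k : H2} (h : IsMul f g k) (h' : IsMul f' g k) : f = f' :=
  Subtype.ext (Lp.ext (h.trans h'.symm))

theorem IsMul.add {f f' g k k' : H2} (h : IsMul f g k) (h' : IsMul f' g k') :
    IsMul (f + f') g (k + k') := by
  unfold IsMul at *
  rw [Submodule.coe_add, Submodule.coe_add]
  filter_upwards [h, h', Lp.coeFn_add (f : L2) (f' : L2), Lp.coeFn_add (k : L2) (k' : L2)]
    with t e₁ e₂ e₃ e₄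
  rw [e₃, e₄, Pi.add_apply, Pi.add_apply, e₁, e₂, mul_add]

theorem IsMul.smul {f g k : H2} (c : ℂ) (h : IsMul f g k) : IsMul (c • f) g (c • k) := by
  unfold IsMul at *
  rw [Submodule.coe_smul, Submodule.coe_smul]
  filter_upwards [h, Lp.coeFn_smul c (f : L2), Lp.coeFn_smul c (k : L2)] with t e₁ e₂ e₃
  rw [e₂, e₃, Pi.smul_apply, Pi.smul_apply, e₁, smul_eq_mul, smul_eq_mul]
  ring

theorem IsMul.zero (g : H2) : IsMul 0 g 0 := by
  simpa using (isMul_S_pow 0 g).smul 0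

theorem IsMul.sum {ι : Type*} (s : Finset ι) {f k : ι → H2} {g : H2}
    (h : ∀ i ∈ s, IsMul (f i) g (k i)) : IsMul (∑ i ∈ s, f i) g (∑ i ∈ s, k i) := by
  classical
  induction s using Finset.induction_on with
  | empty => simpa using IsMul.zero g
  | insert i s his ih =>
    rw [Finset.sum_insert his, Finset.sum_insert his]
    exact (h i (by simp)).add (ih fun j hj => h j (by simp [hj]))

theorem exists_subseq_tendsto_ae {u : ℕ → H2} {f : H2} (h : Tendsto u atTop (𝓝 f)) :
    ∃ ns : ℕ → ℕ, StrictMono ns ∧ ∀ᵐ t ∂mu,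
      Tendsto (fun i => ((u (ns i) : L2) : Circ → ℂ) t) atTop (𝓝 (((f : L2) : Circ → ℂ) t)) :=
  (tendstoInMeasure_of_tendsto_Lp ((continuous_subtype_val.tendsto f).comp h)).exists_seq_tendsto_ae

/-- Multiplication by an unbounded `g` is not continuous on `H²`, so the product is identified
pointwise, along a common subsequence converging almost everywhere. -/
theorem IsMul.of_tendsto {u v : ℕ → H2} {f g k : H2} (hu : Tendsto u atTop (𝓝 f))
    (hv : Tendsto v atTop (𝓝 k)) (h : ∀ n, IsMul (u n) g (v n)) : IsMul f g k := by
  obtain ⟨ns, hns, h1⟩ := exists_subseq_tendsto_ae hu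
  obtain ⟨ms, hms, h2⟩ := exists_subseq_tendsto_ae (hv.comp hns.tendsto_atTop)
  filter_upwards [h1, h2, ae_all_iff.2 h] with t e1 e2 e3
  refine tendsto_nhds_unique (e1.comp hms.tendsto_atTop) ?_
  simpa only [Function.comp_def, e3] using e2.const_mul (((g : L2) : Circ → ℂ) t)

theorem integrable_conj_mul (f g : L2) :
    Integrable (fun t => starRingEnd ℂ ((f : Circ → ℂ) t) * (g : Circ → ℂ) t) mu := by
  refine (L2.integrable_inner f g).congr (Eventually.of_forall fun t => ?_)
  simp only [RCLike.inner_apply]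
  ring

theorem fourierCoeff_conj_mul_neg (f g : H2) (n : ℕ) :
    fourierCoeff (fun t => starRingEnd ℂ (((f : L2) : Circ → ℂ) t) * ((g : L2) : Circ → ℂ) t)
      (-(n : ℤ)) = inner ℂ f ((S ^ n) g) := by
  rw [Submodule.coe_inner, L2.inner_def]
  unfold fourierCoeff
  refine integral_congr_ae ?_
  filter_upwards [coeFn_S_pow n g] with t h
  rw [RCLike.inner_apply, h, neg_neg, smul_eq_mul]
  ring

theorem fourierCoeff_conj_mul (f g : H2) (n : ℕ) :
    fourierCoeff (fun t => starRingEnd ℂ (((f : L2) : Circ → ℂ) t) * ((g : L2) : Circ → ℂ) t)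
      n = inner ℂ ((S ^ n) f) g := by
  rw [Submodule.coe_inner, L2.inner_def]
  unfold fourierCoeff
  refine integral_congr_ae ?_
  filter_upwards [coeFn_S_pow n f] with t h
  rw [RCLike.inner_apply, h, fourier_neg, smul_eq_mul, map_mul]
  ring

/-- An integrable function whose Fourier coefficients vanish annihilates continuous functions. -/
theorem integral_mul_eq_zero_of_fourierCoeff {h : Circ → ℂ} (hi : Integrable h mu)
    (h0 : ∀ n, fourierCoeff h n = 0) (φ : C(Circ, ℂ)) : ∫ t, φ t * h t ∂mu = 0 := by
  have hint : ∀ φ : C(Circ, ℂ), Integrable (fun t => φ t * h t) mu := fun φ =>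
    hi.bdd_mul (c := ‖φ‖) φ.continuous.aestronglyMeasurable
      (Eventually.of_forall fun t => φ.norm_coe_le_norm t)
  let L : C(Circ, ℂ) →L[ℂ] ℂ := LinearMap.mkContinuous
    { toFun := fun φ => ∫ t, φ t * h t ∂mu
      map_add' := fun φ ψ => by
        rw [← integral_add (hint φ) (hint ψ)]
        simp only [ContinuousMap.add_apply, add_mul]
      map_smul' := fun c φ => by
        simp only [ContinuousMap.smul_apply, smul_eq_mul, mul_assoc, RingHom.id_apply]
        exact integral_const_mul c _ } (∫ t, ‖h t‖ ∂mu) fun φ => by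
    change ‖∫ t, φ t * h t ∂mu‖ ≤ _
    refine (norm_integral_le_integral_norm _).trans ?_
    rw [mul_comm, ← integral_const_mul]
    refine integral_mono (hint φ).norm (hi.norm.const_mul _) fun t => ?_
    dsimp only
    rw [norm_mul]
    exact mul_le_mul_of_nonneg_right (φ.norm_coe_le_norm t) (norm_nonneg _)
  have hL : (⊤ : Submodule ℂ C(Circ, ℂ)) ≤ L.ker := by
    rw [← span_fourier_closure_eq_top]
    refine Submodule.topologicalClosure_minimal _ (Submodule.span_le.2 ?_) L.isClosed_ker
    rintro _ ⟨n, rfl⟩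
    have := h0 (-n)
    simp only [fourierCoeff, neg_neg, smul_eq_mul] at this
    exact this
  exact hL (Submodule.mem_top (x := φ))

/-- A unit vector of `H²` that is orthogonal to its shifts is inner. -/
theorem isInner_of_inner_S_pow {θ : H2} (h1 : ‖θ‖ = 1)
    (h2 : ∀ n : ℕ, inner ℂ θ ((S ^ (n + 1)) θ) = 0) : IsInner θ := by
  set w : Circ → ℂ := fun t =>
    starRingEnd ℂ (((θ : L2) : Circ → ℂ) t) * ((θ : L2) : Circ → ℂ) t with hw
  have hwi : Integrable w mu := integrable_conj_mul _ _
  have hself : inner ℂ θ θ = (1 : ℂ) := by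
    rw [inner_self_eq_norm_sq_to_K, h1]; simp
  have hwr : ∀ t, w t = ((‖((θ : L2) : Circ → ℂ) t‖ ^ 2 : ℝ) : ℂ) := fun t => by
    rw [hw]; dsimp only; rw [RCLike.conj_mul]; norm_cast
  have hri : Integrable (fun t => ‖((θ : L2) : Circ → ℂ) t‖ ^ 2) mu :=
    (Lp.memLp (θ : L2)).integrable_norm_pow (p := 2) (by norm_num)
  have hone : ∀ n : ℤ, fourierCoeff (fun _ : Circ => (1 : ℂ)) n = if n = 0 then 1 else 0 := by
    intro n
    have := fourierCoeff_fourier (T := 1) 0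
    have h0 : (fun _ : Circ => (1 : ℂ)) = fourier (T := 1) 0 := by funext t; simp
    rw [h0, this, Pi.single_apply]
  have hcoef : ∀ n, fourierCoeff (fun t => w t - 1) n = 0 := by
    intro n
    have hsub : fourierCoeff (fun t => w t - 1) n
        = fourierCoeff w n - fourierCoeff (fun _ : Circ => (1 : ℂ)) n := by
      unfold fourierCoeff
      simp only [smul_sub]
      refine integral_sub ?_ ?_
      · exact hwi.fourier_smul _
      · exact (integrable_const _).fourier_smul _
    rw [hsub, hone, sub_eq_zero]
    obtain ⟨n, rfl | rfl⟩ := n.eq_nat_or_neg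
    · rw [hw, fourierCoeff_conj_mul]
      cases n with
      | zero => simpa using hself
      | succ n =>
        rw [inner_eq_zero_symm.1 (h2 n), if_neg (by omega)]
    · rw [hw, fourierCoeff_conj_mul_neg]
      cases n with
      | zero => simpa using hself
      | succ n => rw [h2, if_neg (by omega)]
  have hint := integral_mul_eq_zero_of_fourierCoeff (hwi.sub (integrable_const 1)) hcoef
  have hmeas : AEMeasurable (fun t => ENNReal.ofReal (‖((θ : L2) : Circ → ℂ) t‖ ^ 2)) mu :=
    hri.aestronglyMeasurable.aemeasurable.ennreal_ofReal
  have : IsFiniteMeasure (mu.withDensity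
      fun t => ENNReal.ofReal (‖((θ : L2) : Circ → ℂ) t‖ ^ 2)) :=
    isFiniteMeasure_withDensity_ofReal hri.2
  -- `|θ|²` is only known to be integrable, so the `L²` Fourier basis does not apply to it. Instead
  -- the measures `|θ|² dμ` and `dμ` have equal integrals of continuous functions, hence agree, and
  -- so do their densities.
  have hν : mu.withDensity (fun t => ENNReal.ofReal (‖((θ : L2) : Circ → ℂ) t‖ ^ 2))
      = mu.withDensity 1 := by
    rw [withDensity_one]
    refine ext_of_forall_integral_eq_of_IsFiniteMeasure fun φ => ?_
    rw [integral_withDensity_eq_integral_toReal_smul₀ hmeas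
      (Eventually.of_forall fun t => ENNReal.ofReal_lt_top)]
    have := hint ⟨fun t => (φ t : ℂ), Complex.continuous_ofReal.comp φ.continuous⟩
    simp only [ContinuousMap.coe_mk, Pi.sub_apply, hwr] at this
    have h3 : ∫ t, φ t * (‖((θ : L2) : Circ → ℂ) t‖ ^ 2 - 1) ∂mu = 0 := by
      apply Complex.ofReal_injective
      rw [← integral_complex_ofReal, Complex.ofReal_zero, ← this]
      refine integral_congr_ae (Eventually.of_forall fun t => ?_)
      simp
    have hφi : Integrable (fun t => φ t) mu := φ.integrable mu
    have hφw : Integrable (fun t => φ t * ‖((θ : L2) : Circ → ℂ) t‖ ^ 2) mu :=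
      hri.bdd_mul (c := ‖φ‖) φ.continuous.aestronglyMeasurable
        (Eventually.of_forall fun t => φ.norm_coe_le_norm t)
    simp only [mul_sub, mul_one] at h3
    rw [integral_sub hφw hφi, sub_eq_zero] at h3
    rw [← h3]
    refine integral_congr_ae (Eventually.of_forall fun t => ?_)
    simp only [smul_eq_mul]
    rw [ENNReal.toReal_ofReal (by positivity), mul_comm]
  have hae := (withDensity_eq_iff_of_sigmaFinite hmeas aemeasurable_one).1 hν
  filter_upwards [hae] with t ht
  rw [ENNReal.ofReal_eq_one] at ht
  exact (pow_eq_one_iff_of_nonneg (norm_nonneg _) two_ne_zero).1 ht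


theorem inner_smul_right_H2 (c : ℂ) (f g : H2) : inner ℂ f (c • g) = c * inner ℂ f g :=
  inner_smul_right f g c

theorem inner_smul_left_H2 (c : ℂ) (f g : H2) :
    inner ℂ (c • f) g = starRingEnd ℂ c * inner ℂ f g :=
  inner_smul_left f g c

/-! ### Beurling's theorem -/

/-- A functional `⟨e, ·⟩` that does not vanish on a closed subspace is represented there by a
positive multiple of a unit vector. -/
theorem exists_unit_representative {N : Submodule ℂ H2} (hN : IsClosed (N : Set H2)) {e : H2}
    (he : ∃ f ∈ N, inner ℂ e f ≠ 0) :
    ∃ g ∈ N, ‖g‖ = 1 ∧ ∃ c : ℝ, 0 < c ∧ ∀ f ∈ N, inner ℂ e f = c * inner ℂ g f := by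
  have := hN.completeSpace_coe
  obtain ⟨y, hy, z, hz, rfl⟩ := N.exists_add_mem_mem_orthogonal e
  have hyf : ∀ f ∈ N, inner ℂ (y + z) f = inner ℂ y f := fun f hf => by
    rw [inner_add_left, N.inner_left_of_mem_orthogonal hf hz, add_zero]
  have hy0 : y ≠ 0 := by
    rintro rfl
    obtain ⟨f, hf, h⟩ := he
    exact h (by rw [hyf f hf, inner_zero_left])
  refine ⟨((‖y‖⁻¹ : ℝ) : ℂ) • y, N.smul_mem _ hy, ?_, ‖y‖, norm_pos_iff.2 hy0, fun f hf => ?_⟩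
  · rw [norm_smul, Complex.norm_real, norm_inv, norm_norm, inv_mul_cancel₀ (norm_ne_zero_iff.2 hy0)]
  · rw [hyf f hf, inner_smul_left_H2, Complex.conj_ofReal, ← mul_assoc, ← Complex.ofReal_mul,
      mul_inv_cancel₀ (norm_ne_zero_iff.2 hy0), Complex.ofReal_one, one_mul]

/-- Multiplication by an inner function, as an isometry of `H²`. -/
def innerMul {θ : H2} (hθ : IsInner θ) : H2 →ₗᵢ[ℂ] H2 where
  toFun h := (hθ.exists_isMul h).choose
  map_add' f g := ((hθ.exists_isMul (f + g)).choose_spec).unique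
    ((hθ.exists_isMul f).choose_spec.add (hθ.exists_isMul g).choose_spec)
  map_smul' c f := ((hθ.exists_isMul (c • f)).choose_spec).unique
    ((hθ.exists_isMul f).choose_spec.smul c)
  norm_map' f := by
    have h : ∀ᵐ t ∂mu, ‖(((hθ.exists_isMul f).choose : L2) : Circ → ℂ) t‖
        = ‖((f : L2) : Circ → ℂ) t‖ := by
      filter_upwards [(hθ.exists_isMul f).choose_spec, hθ] with t h1 h2
      rw [h1, norm_mul, h2, one_mul]
    exact le_antisymm (Lp.norm_le_norm_of_ae_le (h.mono fun t h => h.le))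
      (Lp.norm_le_norm_of_ae_le (h.mono fun t h => h.ge))

theorem isMul_innerMul {θ : H2} (hθ : IsInner θ) (h : H2) : IsMul (innerMul hθ h) θ h :=
  (hθ.exists_isMul h).choose_spec

theorem innerMul_monomial {θ : H2} (hθ : IsInner θ) (n : ℕ) :
    innerMul hθ (monomial n) = (S ^ n) θ :=
  (isMul_innerMul hθ _).unique (isMul_S_pow n θ)

theorem innerMul_mem_beurling {θ : H2} (hθ : IsInner θ) (h : H2) : innerMul hθ h ∈ beurling θ :=
  ⟨h, Submodule.mem_top, isMul_innerMul hθ h⟩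

theorem beurling_eq_range {θ : H2} (hθ : IsInner θ) :
    beurling θ = LinearMap.range (innerMul hθ).toLinearMap := by
  ext f
  constructor
  · rintro ⟨h, -, hh⟩
    exact ⟨h, (isMul_innerMul hθ h).unique hh⟩
  · rintro ⟨h, rfl⟩
    exact innerMul_mem_beurling hθ h

theorem isClosed_beurling {θ : H2} (hθ : IsInner θ) : IsClosed (beurling θ : Set H2) := by
  rw [beurling_eq_range hθ]
  exact (innerMul hθ).isometry.isClosedEmbedding.isClosed_range

theorem S_pow_mem {N : Submodule ℂ H2} (hS : ∀ f ∈ N, S f ∈ N) (n : ℕ) {f : H2} (hf : f ∈ N) :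
    (S ^ n) f ∈ N := by
  induction n with
  | zero => simpa using hf
  | succ n ih =>
    rw [pow_succ', mul_apply_eq_comp]
    exact hS _ ih

/-- An inner function has no common Fourier modes with a nonzero function: if `v` is orthogonal to
all `zⁿ θ` and all `zⁿ⁺¹ v` are orthogonal to `θ`, then `v = 0`. -/
theorem eq_zero_of_inner_S_pow {θ v : H2} (hθ : IsInner θ)
    (h1 : ∀ n : ℕ, inner ℂ ((S ^ n) θ) v = 0) (h2 : ∀ n : ℕ, inner ℂ θ ((S ^ (n + 1)) v) = 0) :
    v = 0 := by
  have hm : MemLp (fun t => starRingEnd ℂ (((θ : L2) : Circ → ℂ) t) * ((v : L2) : Circ → ℂ) t)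
      2 mu := by
    refine (Lp.memLp (v : L2)).of_le (integrable_conj_mul _ _).aestronglyMeasurable ?_
    filter_upwards [hθ] with t ht
    rw [norm_mul, RCLike.norm_conj, ht, one_mul]
  have h0 : hm.toLp _ = 0 := by
    apply (fourierBasis (T := (1 : ℝ))).repr.injective
    ext n
    rw [fourierBasis_repr, map_zero, fourierCoeff_congr_ae hm.coeFn_toLp]
    obtain ⟨n, rfl | rfl⟩ := n.eq_nat_or_neg
    · rw [fourierCoeff_conj_mul, h1]; rfl
    · rw [fourierCoeff_conj_mul_neg]
      cases n with
      | zero => exact h1 0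
      | succ n => exact h2 n
  apply Subtype.ext
  apply Lp.ext
  have h3 := hm.coeFn_toLp
  rw [h0] at h3
  rw [Submodule.coe_zero]
  filter_upwards [h3, hθ, Lp.coeFn_zero ℂ 2 mu] with t e1 e2 e3
  rw [e3] at e1
  rw [e3]
  refine (mul_eq_zero.1 e1.symm).resolve_left fun h => ?_
  rw [map_eq_zero] at h
  rw [h, norm_zero] at e2
  exact zero_ne_one e2

/-- **Beurling's theorem**: a nonzero closed shift-invariant subspace of `H²` is `θH²` for some
inner function `θ`. -/
theorem exists_eq_beurling {N : Submodule ℂ H2} (hN : IsClosed (N : Set H2))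
    (hS : ∀ f ∈ N, S f ∈ N) (h0 : N ≠ ⊥) : ∃ θ : H2, IsInner θ ∧ N = beurling θ := by
  classical
  -- All of `N` may vanish at `0`, so `θ` is extremal for the first Taylor coefficient that is not
  -- identically zero on `N`.
  have hex : ∃ m, ∃ f ∈ N, inner ℂ (monomial m) f ≠ 0 := by
    by_contra! hcon
    refine h0 ((Submodule.eq_bot_iff _).2 fun f hf => ext_inner_monomial fun n => ?_)
    rw [hcon n f hf, inner_zero_right]
  obtain ⟨θ, hθN, hθ1, c, hc, hθ⟩ := exists_unit_representative hN (Nat.find_spec hex)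
  have horth : ∀ f ∈ N, inner ℂ θ (S f) = 0 := by
    intro f hf
    have h1 := hθ _ (hS f hf)
    -- Coefficient `m` of `z f` is coefficient `m - 1` of `f`, which vanishes by minimality, or
    -- trivially if `m = 0`. Hence `θ` is orthogonal to `zN`.
    have h2 : inner ℂ (monomial (Nat.find hex)) (S f) = 0 := by
      cases hm : Nat.find hex with
      | zero => exact inner_monomial_zero_S f
      | succ m =>
        rw [inner_monomial_succ_S]
        by_contra h
        exact Nat.find_min hex (by omega : m < Nat.find hex) ⟨f, hf, h⟩
    rw [h2] at h1
    exact (mul_eq_zero.1 h1.symm).resolve_left (by exact_mod_cast hc.ne')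
  have hpow : ∀ f ∈ N, ∀ n : ℕ, inner ℂ θ ((S ^ (n + 1)) f) = 0 := by
    intro f hf n
    rw [pow_succ', mul_apply_eq_comp]
    exact horth _ (S_pow_mem hS n hf)
  have hin : IsInner θ := isInner_of_inner_S_pow hθ1 (hpow θ hθN)
  have hle : beurling θ ≤ N := by
    have htop : N.comap (innerMul hin).toLinearMap = ⊤ := by
      refine eq_top_of_monomial_mem (hN.preimage (innerMul hin).continuous) fun n => ?_
      change innerMul hin (monomial n) ∈ N
      rw [innerMul_monomial]
      exact S_pow_mem hS n hθN
    rw [beurling_eq_range hin, LinearMap.range_eq_map, Submodule.map_le_iff_le_comap, htop]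
  refine ⟨θ, hin, le_antisymm (fun f hf => ?_) hle⟩
  have := (isClosed_beurling hin).completeSpace_coe
  obtain ⟨y, hy, z, hz, rfl⟩ := (beurling θ).exists_add_mem_mem_orthogonal f
  have hzN : z ∈ N := by simpa using N.sub_mem hf (hle hy)
  -- Orthogonality of `z` to `θH²` kills one half of the Fourier coefficients of `θ̄ z`, and
  -- orthogonality of `θ` to the shifts of `N` kills the other.
  have hz0 : z = 0 := by
    refine eq_zero_of_inner_S_pow hin (fun n => ?_) (hpow z hzN)
    rw [← innerMul_monomial hin]
    exact hz _ (innerMul_mem_beurling hin _)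
  rwa [hz0, add_zero]

/-! ### Strong stability of the compressed backward shift -/

theorem norm_sub_inner_smul_sq {g : H2} (hg : ‖g‖ = 1) (f : H2) :
    ‖f - (inner ℂ g f : ℂ) • g‖ ^ 2 = ‖f‖ ^ 2 - ‖(inner ℂ g f : ℂ)‖ ^ 2 := by
  have horth : inner ℂ (f - (inner ℂ g f : ℂ) • g) ((inner ℂ g f : ℂ) • g) = (0 : ℂ) := by
    rw [inner_smul_right_H2, inner_sub_left, inner_smul_left_H2, inner_self_eq_norm_sq_to_K, hg,
      inner_conj_symm]
    simp
  have h := norm_add_sq_eq_norm_sq_add_norm_sq_of_inner_eq_zero _ _ horth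
  rw [sub_add_cancel, norm_smul, hg, mul_one] at h
  linarith

/-- The operator `f ↦ S* (f - ⟨f, g⟩ g)`. -/
def hittOp (g : H2) : H2 →L[ℂ] H2 :=
  Sadj ∘L (ContinuousLinearMap.id ℂ H2 - (innerSL ℂ g).smulRight g)

theorem hittOp_apply (g f : H2) : hittOp g f = Sadj (f - (inner ℂ g f : ℂ) • g) := rfl

theorem Sadj_eq_hittOp_add (g f : H2) :
    Sadj f = hittOp g f + (inner ℂ g f : ℂ) • Sadj g := by
  rw [hittOp_apply, map_sub, map_smul, sub_add_cancel]

theorem norm_hittOp_le {g : H2} (hg : ‖g‖ = 1) (f : H2) : ‖hittOp g f‖ ≤ ‖f‖ := by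
  rw [hittOp_apply]
  refine (norm_Sadj_le _).trans (le_of_sq_le_sq ?_ (norm_nonneg _))
  rw [norm_sub_inner_smul_sq hg]
  linarith [sq_nonneg ‖(inner ℂ g f : ℂ)‖]

/-- A discrete variation-of-constants formula, from iterating `S* = T + ⟨g, ·⟩ S* g`. -/
theorem Sadj_pow_succ_eq_sum {g : H2} (hg : ‖g‖ = 1) (n : ℕ) :
    (Sadj ^ (n + 1)) g = ∑ m ∈ Finset.range (n + 1),
      (inner ℂ g ((Sadj ^ (n - m)) g) : ℂ) • (hittOp g ^ m) (Sadj g) := by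
  induction n with
  | zero => simp [hg]
  | succ n ih =>
    rw [pow_succ', mul_apply_eq_comp, Sadj_eq_hittOp_add g, Finset.sum_range_succ']
    nth_rewrite 1 [ih]
    rw [map_sum]
    congr 1
    refine Finset.sum_congr rfl fun m _ => ?_
    rw [map_smul, pow_succ' (hittOp g), mul_apply_eq_comp, Nat.add_sub_add_right]

theorem inner_Sadj_pow_right (n : ℕ) (f g : H2) :
    inner ℂ f ((Sadj ^ n) g) = inner ℂ ((S ^ n) f) g := by
  induction n generalizing f with
  | zero => simp
  | succ n ih =>
    rw [pow_succ', mul_apply_eq_comp, ContinuousLinearMap.adjoint_inner_right, ih, pow_succ,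
      mul_apply_eq_comp]

/-- Identifies the coefficients of `Sadj_pow_succ_eq_sum` as Gram entries of the vectors `Sⁿ g`,
because `S` is an isometry. -/
theorem inner_Sadj_pow_sub (g : H2) {m n : ℕ} (h : m ≤ n) :
    inner ℂ g ((Sadj ^ (n - m)) g) = inner ℂ ((S ^ n) g) ((S ^ m) g) := by
  rw [inner_Sadj_pow_right, ← inner_S_pow_S_pow m, ← mul_apply_eq_comp, ← pow_add,
    Nat.add_sub_cancel' h]

/-- Lower triangular truncations of Gram matrices of unit vectors are bounded below. -/
theorem sum_norm_sq_le_of_gram {E : Type*} [NormedAddCommGroup E] [InnerProductSpace ℂ E]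
    {v : ℕ → E} (hv : ∀ n, ‖v n‖ = 1) (x : ℕ → ℂ) (N : ℕ) :
    ∑ n ∈ Finset.range N, ‖x n‖ ^ 2 ≤ 4 * ∑ n ∈ Finset.range N,
      ‖∑ m ∈ Finset.range (n + 1), InnerProductSpace.toInner.inner (v n) (v m) * x m‖ ^ 2 := by
  set s : ℕ → ℂ := fun n =>
    ∑ m ∈ Finset.range (n + 1), InnerProductSpace.toInner.inner (v n) (v m) * x m with hs
  -- If `L` is the lower triangle and `G` the full Gram matrix, the unit diagonal gives `L + L* = G
  -- + I`. As `G ≥ 0`, this yields `2 Re ⟨x, Lx⟩ ≥ ‖x‖²`.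
  have key : ‖∑ n ∈ Finset.range N, x n • v n‖ ^ 2 + ∑ n ∈ Finset.range N, ‖x n‖ ^ 2
      = ∑ n ∈ Finset.range N, 2 * (starRingEnd ℂ (x n) * s n).re := by
    induction N with
    | zero => simp
    | succ N ih =>
      rw [Finset.sum_range_succ, Finset.sum_range_succ, Finset.sum_range_succ, ← ih,
        norm_add_sq (𝕜 := ℂ), norm_smul, hv, mul_one, ← inner_conj_symm, RCLike.conj_re,
        inner_smul_left, inner_sum]
      have h1 : s N = (∑ m ∈ Finset.range N,
          InnerProductSpace.toInner.inner (v N) (x m • v m)) + x N := by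
        rw [hs]
        dsimp only
        rw [Finset.sum_range_succ, inner_self_eq_norm_sq_to_K, hv]
        congr 1
        · refine Finset.sum_congr rfl fun m _ => ?_
          rw [inner_smul_right, mul_comm]
        · simp
      rw [h1, mul_add, Complex.add_re, RCLike.conj_mul]
      have h2 : (((‖x N‖ : ℂ)) ^ 2).re = ‖x N‖ ^ 2 := by norm_cast
      change _ + 2 * Complex.re _ + _ + _ = _ + 2 * (Complex.re _ + Complex.re ((‖x N‖ : ℂ) ^ 2))
      rw [h2]
      ring
  -- The weights are chosen so that half of `‖x‖²` can be absorbed, which produces the constant `4`.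
  have hbound : ∀ n, 2 * (starRingEnd ℂ (x n) * s n).re ≤ ‖x n‖ ^ 2 / 2 + 2 * ‖s n‖ ^ 2 := by
    intro n
    have h1 := Complex.re_le_norm (starRingEnd ℂ (x n) * s n)
    rw [norm_mul, RCLike.norm_conj] at h1
    nlinarith [sq_nonneg (‖x n‖ - 2 * ‖s n‖)]
  have h := Finset.sum_le_sum fun n (_ : n ∈ Finset.range N) => hbound n
  rw [← key, Finset.sum_add_distrib, ← Finset.sum_div, ← Finset.mul_sum] at h
  nlinarith [sq_nonneg ‖∑ n ∈ Finset.range N, x n • v n‖]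

/-- The scalar Gram bound is applied to each Taylor coefficient and summed over all of them by
Parseval. -/
theorem sum_norm_sq_hittOp_pow_le {g : H2} (hg : ‖g‖ = 1) (N : ℕ) :
    ∑ n ∈ Finset.range N, ‖(hittOp g ^ n) (Sadj g)‖ ^ 2
      ≤ 4 * ∑ n ∈ Finset.range N, ‖(Sadj ^ (n + 1)) g‖ ^ 2 := by
  have h1 := hasSum_sum (s := Finset.range N) fun n _ =>
    hasSum_norm_inner_monomial_sq ((hittOp g ^ n) (Sadj g))
  have h2 := (hasSum_sum (s := Finset.range N) fun n _ =>
    hasSum_norm_inner_monomial_sq ((Sadj ^ (n + 1)) g)).mul_left 4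
  refine hasSum_le (fun l => ?_) h1 h2
  have hv : ∀ n, ‖(S ^ n) g‖ = 1 := fun n => by
    induction n with
    | zero => simpa using hg
    | succ n ih => rw [pow_succ', mul_apply_eq_comp, norm_S, ih]
  refine (sum_norm_sq_le_of_gram hv
    (fun n => inner ℂ (monomial l) ((hittOp g ^ n) (Sadj g))) N).trans_eq ?_
  congr 1
  refine Finset.sum_congr rfl fun n _ => ?_
  rw [Sadj_pow_succ_eq_sum hg, inner_sum]
  congr 2
  refine Finset.sum_congr rfl fun m hm => ?_
  rw [inner_smul_right_H2, inner_Sadj_pow_sub g (Nat.lt_succ_iff.1 (Finset.mem_range.1 hm))]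

theorem antitone_norm_pow_apply {A : H2 →L[ℂ] H2} (hA : ∀ f, ‖A f‖ ≤ ‖f‖) (f : H2) :
    Antitone fun n => ‖(A ^ n) f‖ :=
  antitone_nat_of_succ_le fun n => by
    rw [pow_succ', mul_apply_eq_comp]
    exact hA _

/-- The averages of `‖(S*)ⁿ⁺¹ g‖²` tend to zero by Cesàro. They dominate, up to the factor `4`,
those of `‖Tⁿ S* g‖²`, which is decreasing and so lies below its own averages. -/
theorem Sadj_mem_stableSub_hittOp {g : H2} (hg : ‖g‖ = 1) : Sadj g ∈ stableSub (hittOp g) := by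
  rw [mem_stableSub, tendsto_zero_iff_norm_tendsto_zero]
  have h1 : Tendsto (fun n => ‖(Sadj ^ (n + 1)) g‖ ^ 2) atTop (𝓝 0) := by
    simpa using (((tendsto_Sadj_pow g).comp (tendsto_add_atTop_nat 1)).norm.pow 2)
  have h2 := h1.cesaro.const_mul 4
  rw [mul_zero] at h2
  have h3 : Tendsto (fun n => ‖(hittOp g ^ n) (Sadj g)‖ ^ 2) atTop (𝓝 0) := by
    refine squeeze_zero' (Eventually.of_forall fun n => by positivity) ?_ h2
    filter_upwards [eventually_gt_atTop 0] with n hn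
    have hn' : (0 : ℝ) < n := by exact_mod_cast hn
    have h4 : (n : ℝ) * ‖(hittOp g ^ n) (Sadj g)‖ ^ 2
        ≤ ∑ i ∈ Finset.range n, ‖(hittOp g ^ i) (Sadj g)‖ ^ 2 := by
      rw [← nsmul_eq_mul]
      refine (le_of_eq ?_).trans (Finset.card_nsmul_le_sum (Finset.range n) _
        (‖(hittOp g ^ n) (Sadj g)‖ ^ 2) fun i hi => ?_)
      · rw [Finset.card_range]
      · exact pow_le_pow_left₀ (norm_nonneg _)
          (antitone_norm_pow_apply (norm_hittOp_le hg) _ (Finset.mem_range.1 hi).le) 2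
    have h5 := h4.trans (sum_norm_sq_hittOp_pow_le hg n)
    rw [mul_left_comm, le_inv_mul_iff₀ hn']
    exact h5
  have h6 := (Real.continuous_sqrt.tendsto 0).comp h3
  simpa [Function.comp_def, Real.sqrt_sq] using h6

/-- For a unit vector `g ∈ H²` the powers of `f ↦ S* (f - ⟨f, g⟩ g)` tend strongly to zero. -/
theorem tendsto_hittOp_pow {g : H2} (hg : ‖g‖ = 1) (f : H2) :
    Tendsto (fun n => (hittOp g ^ n) f) atTop (𝓝 0) := by
  have h : stableSub (hittOp g) = ⊤ := by
    refine eq_top_of_monomial_mem (isClosed_stableSub (norm_hittOp_le hg)) fun n => ?_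
    induction n with
    | zero =>
      refine mem_stableSub_of_apply ?_
      rw [hittOp_apply, map_sub, map_smul, Sadj_monomial_zero]
      exact sub_mem (zero_mem _) (Submodule.smul_mem _ _ (Sadj_mem_stableSub_hittOp hg))
    | succ n ih =>
      refine mem_stableSub_of_apply ?_
      rw [hittOp_apply, map_sub, map_smul, Sadj_monomial_succ]
      exact sub_mem ih (Submodule.smul_mem _ _ (Sadj_mem_stableSub_hittOp hg))
  exact mem_stableSub.1 (h ▸ Submodule.mem_top)


/-! ### Hitt's theorem -/

section Hitt

variable {N : Submodule ℂ H2} {g : H2} {c : ℝ}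

/-- `f - ⟨g, f⟩ g` vanishes at `0`, as evaluation at `0` is `c ⟨g, ·⟩` on `N` and `c = g(0)`. Hence
`S` undoes `S*` on it. -/
theorem S_hittOp (hg0 : atZero g = c)
    (hrep : ∀ f ∈ N, inner ℂ (monomial 0) f = c * inner ℂ g f) {f : H2} (hf : f ∈ N) :
    S (hittOp g f) = f - (inner ℂ g f : ℂ) • g := by
  rw [hittOp_apply, S_Sadj_of_inner_monomial_zero]
  rw [inner_sub_right, inner_smul_right_H2, hrep f hf, ← atZero_eq_inner g, hg0, mul_comm, sub_self]

theorem hittOp_mem (hg0 : atZero g = c)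
    (hrep : ∀ f ∈ N, inner ℂ (monomial 0) f = c * inner ℂ g f) (hgN : g ∈ N)
    (hN : ∀ f, S f ∈ N → f ∈ N) {f : H2} (hf : f ∈ N) : hittOp g f ∈ N := by
  refine hN _ ?_
  rw [S_hittOp hg0 hrep hf]
  exact N.sub_mem hf (N.smul_mem _ hgN)

theorem hittOp_pow_mem (hT : ∀ f ∈ N, hittOp g f ∈ N) (n : ℕ) {f : H2} (hf : f ∈ N) :
    (hittOp g ^ n) f ∈ N := by
  induction n with
  | zero => simpa using hf
  | succ n ih =>
    rw [pow_succ', mul_apply_eq_comp]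
    exact hT _ ih

/-- By Pythagoras the partial sums telescope to `‖f‖² - ‖Tⁿ f‖²`, and strong stability removes the
remainder. -/
theorem hasSum_norm_inner_hittOp_pow (hg : ‖g‖ = 1) (hT : ∀ f ∈ N, hittOp g f ∈ N)
    (hS : ∀ f ∈ N, S (hittOp g f) = f - (inner ℂ g f : ℂ) • g) {f : H2} (hf : f ∈ N) :
    HasSum (fun n => ‖(inner ℂ g ((hittOp g ^ n) f) : ℂ)‖ ^ 2) (‖f‖ ^ 2) := by
  rw [hasSum_iff_tendsto_nat_of_nonneg fun n => by positivity]
  have hsum : ∀ n, ∑ i ∈ Finset.range n, ‖(inner ℂ g ((hittOp g ^ i) f) : ℂ)‖ ^ 2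
      = ‖f‖ ^ 2 - ‖(hittOp g ^ n) f‖ ^ 2 := by
    intro n
    induction n with
    | zero => simp
    | succ n ih =>
      have h := norm_sub_inner_smul_sq hg ((hittOp g ^ n) f)
      rw [← hS _ (hittOp_pow_mem hT n hf), norm_S] at h
      rw [Finset.sum_range_succ, ih, pow_succ' (hittOp g), mul_apply_eq_comp, h]
      ring
  simp only [hsum]
  simpa using ((tendsto_hittOp_pow hg f).norm.pow 2).const_sub (‖f‖ ^ 2)

theorem eq_sum_add_S_pow_hittOp_pow (hT : ∀ f ∈ N, hittOp g f ∈ N)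
    (hS : ∀ f ∈ N, S (hittOp g f) = f - (inner ℂ g f : ℂ) • g) {f : H2} (hf : f ∈ N) (n : ℕ) :
    f = ∑ i ∈ Finset.range n, (inner ℂ g ((hittOp g ^ i) f) : ℂ) • (S ^ i) g
      + (S ^ n) ((hittOp g ^ n) f) := by
  induction n with
  | zero => simp
  | succ n ih =>
    rw [Finset.sum_range_succ, pow_succ S, mul_apply_eq_comp, pow_succ' (hittOp g),
      mul_apply_eq_comp, hS _ (hittOp_pow_mem hT n hf), map_sub, map_smul]
    nth_rewrite 1 [ih]
    abel

theorem norm_S_pow (n : ℕ) (f : H2) : ‖(S ^ n) f‖ = ‖f‖ := by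
  induction n with
  | zero => simp
  | succ n ih => rw [pow_succ', mul_apply_eq_comp, norm_S, ih]

/-- The isometry `f ↦ f / g` of a nearly invariant subspace with extremal function `g` into
`H²`. -/
theorem exists_isometry_isMul (hg : ‖g‖ = 1) (hT : ∀ f ∈ N, hittOp g f ∈ N)
    (hS : ∀ f ∈ N, S (hittOp g f) = f - (inner ℂ g f : ℂ) • g) :
    ∃ V : N →ₗᵢ[ℂ] H2,
      (∀ (f : N) (n : ℕ), inner ℂ (monomial n) (V f) = inner ℂ g ((hittOp g ^ n) (f : H2))) ∧
      ∀ f : N, IsMul f g (V f) := by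
  have hex : ∀ f : N, ∃ k : H2,
      ∀ n, inner ℂ (monomial n) k = inner ℂ g ((hittOp g ^ n) (f : H2)) := by
    intro f
    have hmem : Memℓp (fun n : ℕ => (inner ℂ g ((hittOp g ^ n) (f : H2)) : ℂ)) 2 := by
      refine memℓp_gen ?_
      simpa using (hasSum_norm_inner_hittOp_pow hg hT hS f.2).summable
    refine ⟨monomialBasis.repr.symm ⟨_, hmem⟩, fun n => ?_⟩
    rw [← monomialBasis_apply]
    refine (HilbertBasis.repr_apply_apply _ _ _).symm.trans ?_
    rw [LinearIsometryEquiv.apply_symm_apply]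
  choose V hV using hex
  refine ⟨⟨⟨⟨V, fun f f' => ext_inner_monomial fun n => ?_⟩,
    fun a f => ext_inner_monomial fun n => ?_⟩, fun f => ?_⟩, hV, fun f => ?_⟩
  · rw [hV, inner_add_right, hV, hV, Submodule.coe_add, map_add, inner_add_right]
  · rw [hV, RingHom.id_apply, inner_smul_right_H2, hV, Submodule.coe_smul, map_smul,
      inner_smul_right_H2]
  · have h1 := hasSum_norm_inner_monomial_sq (V f)
    simp only [hV] at h1
    exact (sq_eq_sq₀ (norm_nonneg _) (norm_nonneg _)).1
      (h1.unique (hasSum_norm_inner_hittOp_pow hg hT hS f.2))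
  · have hv : Tendsto (fun n => ∑ i ∈ Finset.range n,
        (inner ℂ g ((hittOp g ^ i) (f : H2)) : ℂ) • monomial i) atTop (𝓝 (V f)) := by
      refine (monomialBasis.hasSum_repr (V f)).tendsto_sum_nat.congr fun n =>
        Finset.sum_congr rfl fun i _ => ?_
      rw [HilbertBasis.repr_apply_apply, monomialBasis_apply]
      exact congrArg (· • monomial i) (hV f i)
    -- The remainder `Sⁿ Tⁿ f` has norm `‖Tⁿ f‖`, which tends to zero.
    have hu : Tendsto (fun n => ∑ i ∈ Finset.range n,
        (inner ℂ g ((hittOp g ^ i) (f : H2)) : ℂ) • (S ^ i) g) atTop (𝓝 (f : H2)) := by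
      rw [tendsto_iff_norm_sub_tendsto_zero, ← norm_zero (E := H2)]
      refine (tendsto_hittOp_pow hg (f : H2)).norm.congr fun n => ?_
      rw [norm_sub_rev, ← norm_S_pow n]
      exact congrArg norm (eq_sub_of_add_eq' (eq_sum_add_S_pow_hittOp_pow hT hS f.2 n).symm)
    exact IsMul.of_tendsto hu hv fun n => IsMul.sum _ fun i _ => (isMul_S_pow i g).smul _

/-- **Hitt's theorem**: a nonzero nearly `S*`-invariant subspace of `H²` is either `γH²` with `γ`
inner and `γ(0) ≠ 0`, or `gK_β` with extremal function `g`. -/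
theorem nearlyInvariant_classification (hcl : IsClosed (N : Set H2))
    (hN : ∀ f, S f ∈ N → f ∈ N) (h0 : N ≠ ⊥) :
    (∃ γ : H2, IsInner γ ∧ atZero γ ≠ 0 ∧ N = beurling γ) ∨
    (∃ β g : H2, IsInner β ∧ MulsInto g (model β) ∧ IsExtremal g (mulSub g (model β)) ∧
      N = mulSub g (model β)) := by
  have hex : ∃ f ∈ N, inner ℂ (monomial 0) f ≠ 0 := by
    -- If all of `N` vanished at `0`, then `N` would be `S*`-invariant. The `n`th coefficient of `f`
    -- is the value of `(S*)ⁿ f` at `0`, so `N` would be zero.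
    by_contra! hcon
    have hpow : ∀ n : ℕ, ∀ f ∈ N, (Sadj ^ n) f ∈ N := by
      intro n f hf
      induction n with
      | zero => simpa using hf
      | succ n ih =>
        rw [pow_succ', mul_apply_eq_comp]
        refine hN _ ?_
        rwa [S_Sadj_of_inner_monomial_zero (hcon _ ih)]
    refine h0 ((Submodule.eq_bot_iff _).2 fun f hf => ext_inner_monomial fun n => ?_)
    have h1 := hcon _ (hpow n f hf)
    rw [inner_Sadj_pow_right, S_pow_monomial, zero_add] at h1
    rw [h1, inner_zero_right]
  obtain ⟨g, hgN, hg, c, hc, hrep⟩ := exists_unit_representative hcl hex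
  have hg0 : atZero g = c := by
    rw [atZero_eq_inner, hrep g hgN, inner_self_eq_norm_sq_to_K, hg]
    simp
  have hS : ∀ f ∈ N, S (hittOp g f) = f - (inner ℂ g f : ℂ) • g := fun f hf =>
    S_hittOp hg0 hrep hf
  have hT : ∀ f ∈ N, hittOp g f ∈ N := fun f hf => hittOp_mem hg0 hrep hgN hN hf
  obtain ⟨V, hV, hmul⟩ := exists_isometry_isMul hg hT hS
  have hNK : N = mulSub g (LinearMap.range V.toLinearMap) := by
    ext f
    constructor
    · intro hf
      exact ⟨V ⟨f, hf⟩, ⟨_, rfl⟩, hmul ⟨f, hf⟩⟩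
    · rintro ⟨_, ⟨f', rfl⟩, h⟩
      rw [h.unique (hmul f')]
      exact f'.2
  have hinto : MulsInto g (LinearMap.range V.toLinearMap) := by
    rintro _ ⟨f, rfl⟩
    exact ⟨f, hmul f⟩
  have hext : IsExtremal g N := by
    refine ⟨hgN, hg, fun f hf hf0 => ?_, ?_, ?_⟩
    · rw [atZero_eq_inner, hrep f hf] at hf0
      have h1 := (mul_eq_zero.1 hf0).resolve_left (by exact_mod_cast hc.ne')
      exact inner_eq_zero_symm.1 h1
    · rw [hg0]; exact_mod_cast hc
    · rw [hg0, Complex.ofReal_im]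
  have := hcl.completeSpace_coe
  have hKcl : IsClosed (LinearMap.range V.toLinearMap : Set H2) :=
    V.isometry.isClosedEmbedding.isClosed_range
  have := hKcl.completeSpace_coe
  have hKS : ∀ x ∈ (LinearMap.range V.toLinearMap)ᗮ, S x ∈ (LinearMap.range V.toLinearMap)ᗮ := by
    rintro x hx _ ⟨f, rfl⟩
    -- Dropping the first coefficient of `V f` amounts to replacing `f` by `T f`, so the range of
    -- `V` is `S*`-invariant.
    have hVT : Sadj (V f) = V ⟨hittOp g f, hT f f.2⟩ := by
      refine ext_inner_monomial fun n => ?_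
      rw [inner_monomial_Sadj, hV, hV, pow_succ, mul_apply_eq_comp]
    change inner ℂ (V f) (S x) = 0
    rw [← ContinuousLinearMap.adjoint_inner_left, hVT]
    exact hx _ ⟨_, rfl⟩
  by_cases hbot : (LinearMap.range V.toLinearMap)ᗮ = ⊥
  · left
    have htop : LinearMap.range V.toLinearMap = ⊤ := Submodule.orthogonal_eq_bot_iff.1 hbot
    refine ⟨g, isInner_of_inner_S_pow hg fun n => ?_, ?_, ?_⟩
    -- If `V f = zⁿ⁺¹` then `f = zⁿ⁺¹ g`, while `⟨g, f⟩` is the zeroth coefficient of `V f`, which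
    -- is `0`.
    · obtain ⟨f, hf⟩ : monomial (n + 1) ∈ LinearMap.range V.toLinearMap :=
        htop ▸ Submodule.mem_top
      change V f = _ at hf
      have h1 := hV f 0
      have h2 := hmul f
      rw [hf] at h1 h2
      rw [(isMul_S_pow (n + 1) g).unique h2]
      rw [orthonormal_monomial.2 (by omega)] at h1
      exact h1.symm
    · rw [hg0]; exact_mod_cast hc.ne'
    · rw [beurling, ← htop]; exact hNK
  · right
    obtain ⟨β, hβ, hK⟩ := exists_eq_beurling (Submodule.isClosed_orthogonal _) hKS hbot
    have hmodel : model β = LinearMap.range V.toLinearMap := by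
      rw [model, ← hK, Submodule.orthogonal_orthogonal]
    refine ⟨β, g, hβ, ?_, ?_, ?_⟩
    · rwa [hmodel]
    · rwa [hmodel, ← hNK]
    · rwa [hmodel]

end Hitt

/-! ### Splitting subspaces -/

theorem adjoint_SSstar_apply (x y : H2) :
    ContinuousLinearMap.adjoint SSstar (WithLp.toLp 2 (x, y)) = WithLp.toLp 2 (Sadj x, S y) := by
  refine ext_inner_right ℂ fun w => ?_
  rw [ContinuousLinearMap.adjoint_inner_left]
  change inner ℂ x (S w.fst) + inner ℂ y (Sadj w.snd) = inner ℂ (Sadj x) w.fst + inner ℂ (S y) w.snd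
  rw [ContinuousLinearMap.adjoint_inner_left, ContinuousLinearMap.adjoint_inner_right]

theorem toLp_mem_directSum {N₁ N₂ : Submodule ℂ H2} {x y : H2} :
    WithLp.toLp 2 (x, y) ∈ directSum N₁ N₂ ↔ x ∈ N₁ ∧ y ∈ N₂ := Iff.rfl

/-- Since `S* S = 1`, the pair `(x, S y)` is the image of `(S x, y)` under the adjoint `S* ⊕ S`, so
the range condition constrains only the second component. -/
theorem directSum_nearlyInvariant {N₁ N₂ : Submodule ℂ H2}
    (h : IsNearlyInvariant SSstar (directSum N₁ N₂)) :
    (∀ f ∈ N₁, S f ∈ N₁) ∧ ∀ f, S f ∈ N₂ → f ∈ N₂ := by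
  have key : ∀ x y : H2, x ∈ N₁ → S y ∈ N₂ → S x ∈ N₁ ∧ y ∈ N₂ := by
    intro x y hx hy
    have h1 : SSstar (WithLp.toLp 2 (x, S y)) ∈ directSum N₁ N₂ :=
      h.2 ⟨_, ⟨toLp_mem_directSum.2 ⟨hx, hy⟩, WithLp.toLp 2 (S x, y), by
        rw [adjoint_SSstar_apply, Sadj_S]⟩, rfl⟩
    have h2 : S x ∈ N₁ ∧ Sadj (S y) ∈ N₂ := h1
    rwa [Sadj_S] at h2
  exact ⟨fun f hf => (key f 0 hf (by simp)).1, fun f hf => (key 0 f (zero_mem _) hf).2⟩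

/-- The unimodular constant `1` is inner, and its model space is zero. -/
theorem isInner_monomial_zero : IsInner (monomial 0) := by
  filter_upwards [coeFn_monomial 0] with t h
  rw [h, norm_fourier_apply]

theorem model_monomial_zero : model (monomial 0) = ⊥ := by
  have h : beurling (monomial 0) = ⊤ := by
    refine eq_top_of_monomial_mem (isClosed_beurling isInner_monomial_zero) fun n => ?_
    have := innerMul_mem_beurling isInner_monomial_zero (monomial n)
    rwa [innerMul_monomial, S_pow_monomial, zero_add] at this
  rw [model, h, Submodule.top_orthogonal_eq_bot]

end Hardy

end

theorem corollary3p7 (M : Submodule ℂ Hardy.H2C2) (hM : M ≠ ⊥) (hsplit : Hardy.IsSplitting M)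
    (hnear : Hardy.IsNearlyInvariant Hardy.SSstar M) :
    (∃ α β : Hardy.H2, Hardy.IsInner α ∧ Hardy.IsInner β ∧
      M = Hardy.directSum (Hardy.beurling α) (Hardy.model β)) ∨
    (∃ β : Hardy.H2, Hardy.IsInner β ∧
      M = Hardy.directSum ⊥ (Hardy.model β)) ∨
    (∃ α γ : Hardy.H2, Hardy.IsInner α ∧ Hardy.IsInner γ ∧ Hardy.atZero γ ≠ 0 ∧
      M = Hardy.directSum (Hardy.beurling α) (Hardy.beurling γ)) ∨
    (∃ γ : Hardy.H2, Hardy.IsInner γ ∧ Hardy.atZero γ ≠ 0 ∧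
      M = Hardy.directSum ⊥ (Hardy.beurling γ)) ∨
    (∃ α β g : Hardy.H2, Hardy.IsInner α ∧ Hardy.IsInner β ∧
      Hardy.MulsInto g (Hardy.model β) ∧
      Hardy.IsExtremal g (Hardy.mulSub g (Hardy.model β)) ∧
      M = Hardy.directSum (Hardy.beurling α) (Hardy.mulSub g (Hardy.model β))) ∨
    (∃ β g : Hardy.H2, Hardy.IsInner β ∧
      Hardy.MulsInto g (Hardy.model β) ∧
      Hardy.IsExtremal g (Hardy.mulSub g (Hardy.model β)) ∧
      M = Hardy.directSum ⊥ (Hardy.mulSub g (Hardy.model β))) := by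
  obtain ⟨N₁, N₂, h₁, h₂, rfl⟩ := hsplit
  obtain ⟨hS, hN⟩ := Hardy.directSum_nearlyInvariant hnear
  by_cases h20 : N₂ = ⊥
  · obtain rfl := h20.trans Hardy.model_monomial_zero.symm
    by_cases h10 : N₁ = ⊥
    · rw [h10]
      exact Or.inr (Or.inl ⟨_, Hardy.isInner_monomial_zero, rfl⟩)
    · obtain ⟨α, hα, rfl⟩ := Hardy.exists_eq_beurling h₁ hS h10
      exact Or.inl ⟨α, _, hα, Hardy.isInner_monomial_zero, rfl⟩
  · by_cases h10 : N₁ = ⊥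
    · subst h10
      obtain ⟨γ, hγ, hγ0, rfl⟩ | ⟨β, g, hβ, hi, he, rfl⟩ :=
        Hardy.nearlyInvariant_classification h₂ hN h20
      · exact Or.inr (Or.inr (Or.inr (Or.inl ⟨γ, hγ, hγ0, rfl⟩)))
      · exact Or.inr (Or.inr (Or.inr (Or.inr (Or.inr ⟨β, g, hβ, hi, he, rfl⟩))))
    · obtain ⟨α, hα, rfl⟩ := Hardy.exists_eq_beurling h₁ hS h10
      obtain ⟨γ, hγ, hγ0, rfl⟩ | ⟨β, g, hβ, hi, he, rfl⟩ :=
        Hardy.nearlyInvariant_classification h₂ hN h20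
      · exact Or.inr (Or.inr (Or.inl ⟨α, γ, hα, hγ, hγ0, rfl⟩))
      · exact Or.inr (Or.inr (Or.inr (Or.inr (Or.inl ⟨α, β, g, hα, hβ, hi, he, rfl⟩))))
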